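/- Let $E$ be a uniformly convex and uniformly smooth real Banach space with dual $E^*$, let $J:E\to E^*$ be its normalized duality mapping ($\langle x,Jx\rangle=\|x\|^2=\|Jx\|^2$), and let $\phi(x,y)=\|x\|^2-2\langle x,Jy\rangle+\|y\|^2$. For a nonempty closed convex set $K\subset E$ let $\Pi_K y$ denote the point of $K$ at which $\phi(\cdot,y)$ attains its minimum over $K$. Let $C$ be a nonempty closed convex subset of $E$. Let $f_1,f_2:C\times C\to\mathbb R$ be bifunctions such that each $f\in\{f_1,f_2\}$ satisfies (A1) $f(x,x)=0$ for all $x\in C$; (A2) $f(x,y)+f(y,x)\le 0$ for all $x,y\in C$; (A3) $\limsup_{t\to0^+}f(tz+(1-t)x,y)\le f(x,y)$ for all $x,y,z\in C$; (A4) for each $x\in C$, $y\mapsto f(x,y)$ is convex and lower semicontinuous on $C$. Put $EP(f)=\{u\in C: f(u,v)\ge 0\ \ \forall v\in C\}$. Let $d\ge 1$ and let $T_1,\dots,T_d:C\to C$ be continuous and relatively nonexpansive; the latter means, for $T=T_j$ with fixed point set $F(T)$, that $F(T)\neq\emptyset$, that $\phi(p,Tx)\le\phi(p,x)$ for all $x\in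 C$ and $p\in F(T)$, and that $F(T)$ coincides with the set of those $p\in C$ that are the weak limit of a sequence $(s_n)$ in $C$ with $\|s_n-Ts_n\|\to0$. Assume that $$F:=\bigcap_{j=1}^d F(T_j)\cap EP(f_1)\cap EP(f_2)\neq\emptyset .$$ Let $\beta\in(0,1)$, and for $n\ge 0$ let $\alpha_n\in(0,1)$ and $r_n\ge c_1$, where $c_1>0$, with $\liminf_{n\to\infty}\alpha_n(1-\alpha_n)>0$. Write $T_n=T_{n \bmod d}$, the residue being taken in $\{1,\dots,d\}$. Consider the scheme: $x_0\in C_0=C$ is arbitrary and, for $n\ge0$, $$y_n=J^{-1}\big(\alpha_nJx_n+(1-\alpha_n)JT_{n+1}x_n\big),$$ $$u_n\in C:\quad f_1(u_n,y)+\tfrac1{r_n}\langle y-u_n,Ju_n-Jy_n\rangle\ge0\quad\forall y\in C,$$ $$v_n\in C:\quad f_2(v_n,y)+\tfrac1{r_n}\langle y-v_n,Jv_n-Jy_n\rangle\ge0\quad\forall y\in C,$$ $$w_n=J^{-1}\big(\beta Ju_n+(1-\beta)Jv_n\big),$$ $$C_{n+1}=\{z\in C_n:\ \phi(z,w_n)\le\phi(z,x_n)\},\qquad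 x_{n+1}=\Pi_{C_{n+1}}(x_0).$$ Then for every $x_0\in C$ there are sequences satisfying the scheme, and every sequence $(x_n)_{n\ge0}$ obtained from the scheme converges strongly (in norm) to some element of $F$. -/

import Mathlib

open Filter Topology

namespace HybridEquilibrium

section Duality

variable {E : Type*} [NormedAddCommGroup E] [NormedSpace ℝ E]

/-- The (set-valued) normalized duality mapping `J : E → 2^{E*}`. -/
def dualitySet (x : E) : Set (StrongDual ℝ E) :=
  {g | g x = ‖x‖ ^ 2 ∧ ‖g‖ ^ 2 = ‖x‖ ^ 2}

/-- By Hahn-Banach the normalized duality mapping has nonempty values. -/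
theorem dualitySet_nonempty (x : E) : (dualitySet x).Nonempty := by
  obtain ⟨g, hg1, hg2⟩ := exists_dual_vector'' ℝ x
  by_cases hx : x = 0
  · exact ⟨0, by simp [dualitySet, hx]⟩
  · have hpos : 0 < ‖x‖ := norm_pos_iff.mpr hx
    have hg2' : g x = ‖x‖ := by simpa using hg2
    have hg3 : ‖g‖ = 1 := by
      refine le_antisymm hg1 ?_
      have h := g.le_opNorm x
      rw [hg2', Real.norm_of_nonneg hpos.le] at h
      nlinarith
    refine ⟨‖x‖ • g, ?_, ?_⟩
    · simp [hg2', pow_two]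
    · simp [norm_smul, hg3]

/-- The normalized duality mapping as a single-valued map.  On a smooth space `dualitySet x` is
a singleton, so that no choice is involved. -/
noncomputable def J (x : E) : StrongDual ℝ E := (dualitySet_nonempty x).some

/-- The functional `φ(x, y) = ‖x‖² - 2⟨x, Jy⟩ + ‖y‖²`. -/
noncomputable def phi (x y : E) : ℝ := ‖x‖ ^ 2 - 2 * J y x + ‖y‖ ^ 2

/-- `p = Π_K y`: the point `p` of `K` minimizes `φ(·, y)` over `K`. -/
def IsGenProj (K : Set E) (y p : E) : Prop :=
  p ∈ K ∧ ∀ z ∈ K, phi p y ≤ phi z y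

end Duality

section Smoothness

variable (E : Type*) [NormedAddCommGroup E] [NormedSpace ℝ E]

/-- The modulus of smoothness `ρ_E(τ)`. -/
noncomputable def modulusOfSmoothness (τ : ℝ) : ℝ :=
  sSup {s : ℝ | ∃ x y : E, ‖x‖ = 1 ∧ ‖y‖ = τ ∧ s = (‖x + y‖ + ‖x - y‖) / 2 - 1}

/-- `E` is uniformly smooth: `ρ_E(τ) / τ → 0` as `τ → 0⁺`. -/
def UniformlySmooth : Prop :=
  Tendsto (fun τ : ℝ => modulusOfSmoothness E τ / τ) (𝓝[>] 0) (𝓝 0)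

end Smoothness

section Problems

variable {E : Type*} [NormedAddCommGroup E] [NormedSpace ℝ E]

/-- The set `F(T)` of fixed points of `T : C → C`. -/
def fixedPointSet (C : Set E) (T : E → E) : Set E := {p | p ∈ C ∧ T p = p}

/-- The set of asymptotic fixed points of `T : C → C`: points of `C` that are weak limits of
sequences `s` in `C` with `‖s n - T (s n)‖ → 0`. -/
def asymptoticFixedPointSet (C : Set E) (T : E → E) : Set E :=
  {p | p ∈ C ∧ ∃ s : ℕ → E, (∀ n, s n ∈ C) ∧
    (∀ g : StrongDual ℝ E, Tendsto (fun n => g (s n)) atTop (𝓝 (g p))) ∧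
    Tendsto (fun n => ‖s n - T (s n)‖) atTop (𝓝 0)}

/-- `T` is a relatively nonexpansive mapping from `C` into itself (only the values of `T` on `C`
matter). -/
structure RelativelyNonexpansive (C : Set E) (T : E → E) : Prop where
  mapsTo : Set.MapsTo T C C
  nonempty : (fixedPointSet C T).Nonempty
  phi_le : ∀ x ∈ C, ∀ p ∈ fixedPointSet C T, phi p (T x) ≤ phi p x
  fixed_eq : fixedPointSet C T = asymptoticFixedPointSet C T

/-- The conditions (A1)-(A4) on a bifunction `f : C × C → ℝ` (only the values of `f` on `C × C`
matter).  The third one says `limsup_{t → 0⁺} f(tz + (1 - t)x, y) ≤ f(x, y)`. -/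
structure EquilibriumConditions (C : Set E) (f : E → E → ℝ) : Prop where
  diag : ∀ x ∈ C, f x x = 0
  monotone : ∀ x ∈ C, ∀ y ∈ C, f x y + f y x ≤ 0
  hemicontinuous : ∀ x ∈ C, ∀ y ∈ C, ∀ z ∈ C, ∀ a : ℝ, f x y < a →
    ∀ᶠ t : ℝ in 𝓝[>] 0, f (t • z + (1 - t) • x) y < a
  convex : ∀ x ∈ C, ConvexOn ℝ C (f x)
  lsc : ∀ x ∈ C, LowerSemicontinuousOn (f x) C

/-- The solution set `EP(f)` of the equilibrium problem for `f` on `C`. -/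
def EP (C : Set E) (f : E → E → ℝ) : Set E := {u | u ∈ C ∧ ∀ v ∈ C, 0 ≤ f u v}

/-- The sequences `x, y, u, v, w` of points and the sequence `K` of sets (`C_n` is `K n`) obey the
hybrid scheme for the bifunctions `f₁, f₂` and the maps `S n` (the map used in step `n`).
A relation `y = J⁻¹ g` is written `J y = g`. -/
structure IsHybridScheme (C : Set E) (f₁ f₂ : E → E → ℝ) (S : ℕ → E → E)
    (α r : ℕ → ℝ) (β : ℝ) (x y u v w : ℕ → E) (K : ℕ → Set E) : Prop where
  x_zero : x 0 ∈ C
  K_zero : K 0 = C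
  y_eq : ∀ n, J (y n) = α n • J (x n) + (1 - α n) • J (S n (x n))
  u_mem : ∀ n, u n ∈ C
  u_ineq : ∀ n, ∀ z ∈ C, 0 ≤ f₁ (u n) z + 1 / r n * (J (u n) - J (y n)) (z - u n)
  v_mem : ∀ n, v n ∈ C
  v_ineq : ∀ n, ∀ z ∈ C, 0 ≤ f₂ (v n) z + 1 / r n * (J (v n) - J (y n)) (z - v n)
  w_eq : ∀ n, J (w n) = β • J (u n) + (1 - β) • J (v n)
  K_succ : ∀ n, K (n + 1) = {z | z ∈ K n ∧ phi z (w n) ≤ phi z (x n)}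
  x_succ : ∀ n, IsGenProj (K (n + 1)) (x 0) (x (n + 1))

end Problems

end HybridEquilibrium

namespace HybridEquilibrium

/-! ### Algebra of `J` and `phi` -/

section Basic

variable {E : Type*} [NormedAddCommGroup E] [NormedSpace ℝ E]

/-! Convergence. Every q in `F` lies in every C_n, because one step cannot increase φ(q, ·): the
maps and the resolvents both decrease it, and φ(q, y) behaves affinely in Jy up to nonnegative
corrections. Generalized projections onto decreasing convex sets with a common point are Cauchy by
uniform convexity (`cauchySeq_of_isGenProj`), so x_n → p. Since x_{n+1} lies in C_{n+1}, φ(x_{n+1},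
w_n) → 0 and w_n → p. Hence φ(q, x_n) - φ(q, w_n) → 0. By `phi_step_le` this difference dominates
every correction, namely weighted copies of φ(u_n, y_n), φ(v_n, y_n), φ(y_n, x_n) and φ(y_n,
T_{n+1}x_n). So all these sequences tend to p. Minty's lemma puts p in both equilibrium sets, and
continuity of T_j along a residue class gives T_j p = p.

Existence. Three things must be solvable: Jy = g, the resolvent inequality, and the projection. The
first and third are minimizations of ‖z‖² minus a functional. The second reduces to a coercive
equilibrium problem, solved by finite-dimensional separation (`exists_forall_lt`). In both cases
`exists_forall_mem_of_directed` takes the place of weak compactness. -/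

theorem J_apply_self (x : E) : J x x = ‖x‖ ^ 2 := (dualitySet_nonempty x).some_mem.1

theorem norm_J (x : E) : ‖J x‖ = ‖x‖ :=
  (sq_eq_sq₀ (norm_nonneg _) (norm_nonneg _)).1 (dualitySet_nonempty x).some_mem.2

theorem J_apply_le (x z : E) : J x z ≤ ‖x‖ * ‖z‖ := by
  have h := (J x).le_opNorm z
  rw [norm_J] at h
  exact (le_abs_self _).trans h

theorem sq_norm_sub_le_phi (x y : E) : (‖x‖ - ‖y‖) ^ 2 ≤ phi x y := by
  have h := J_apply_le y x
  unfold phi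
  nlinarith

theorem phi_nonneg (x y : E) : 0 ≤ phi x y := (sq_nonneg _).trans (sq_norm_sub_le_phi x y)

/-- The right side tends to 0 when x and y converge to the same point, so φ → 0 follows without norm
continuity of `J`. -/
theorem phi_le (x y : E) : phi x y ≤ ‖x‖ ^ 2 - ‖y‖ ^ 2 + 2 * (‖y‖ * ‖x - y‖) := by
  have h := J_apply_le y (y - x)
  rw [map_sub, J_apply_self, norm_sub_rev] at h
  unfold phi
  linarith

/-- `J y` is a subgradient of `‖·‖² / 2` at `y`. -/
theorem norm_sq_add_le (y h : E) (t : ℝ) : ‖y‖ ^ 2 + 2 * t * J y h ≤ ‖y + t • h‖ ^ 2 := by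
  have h1 := J_apply_le y (y + t • h)
  rw [map_add, map_smul, J_apply_self, smul_eq_mul] at h1
  nlinarith [sq_nonneg (‖y‖ - ‖y + t • h‖)]

/-- An exact identity rather than convexity: the terms φ(y, x) and φ(y, z) are the corrections that
the convergence proof later forces to 0. -/
theorem phi_convexCombination {x y z : E} {a : ℝ} (h : J y = a • J x + (1 - a) • J z) (q : E) :
    phi q y + (a * phi y x + (1 - a) * phi y z) = a * phi q x + (1 - a) * phi q z := by
  have h1 : J y q = a * J x q + (1 - a) * J z q := by rw [h]; simp
  have h2 : ‖y‖ ^ 2 = a * J x y + (1 - a) * J z y := by rw [← J_apply_self y, h]; simp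
  unfold phi
  linear_combination (-2) * h1 + 2 * h2

theorem phi_sub_sub (u y p : E) :
    phi p y - phi p u - phi u y = 2 * (J u - J y) (p - u) := by
  have h := J_apply_self u
  simp only [phi, map_sub, sub_apply]
  linear_combination 2 * h

theorem convexOn_norm_sq_sub (g : StrongDual ℝ E) :
    ConvexOn ℝ Set.univ fun z : E => ‖z‖ ^ 2 - g z :=
  ((convexOn_norm convex_univ).pow (fun _ _ => norm_nonneg _) 2).sub
    (g.toLinearMap.concaveOn convex_univ)

end Basic

/-! ### Uniform convexity: quantitative estimates, intersections and minimizers -/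

section UniformConvexity

variable {E : Type*} [NormedAddCommGroup E] [NormedSpace ℝ E] [UniformConvexSpace E]

/-- The squared norm of a uniformly convex space is uniformly convex on bounded sets. -/
theorem exists_norm_sub_lt {ε : ℝ} (hε : 0 < ε) (R : ℝ) :
    ∃ η > 0, ∀ a b : E, ‖a‖ ≤ R → ‖b‖ ≤ R →
      2 * (‖a‖ ^ 2 + ‖b‖ ^ 2) - η ≤ ‖a + b‖ ^ 2 → ‖a - b‖ < ε := by
  have hR' : 0 < max R 1 := lt_max_of_lt_right one_pos
  obtain ⟨δ, hδ, H⟩ := exists_forall_closed_ball_dist_add_le_two_mul_sub E (div_pos hε hR') 1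
  -- A defect of at most κ² gives ‖a‖ - ‖b‖ ≤ κ. If ‖a - b‖ ≥ ε, rescaling by ‖a‖ ≥ ε / 2 yields ‖a
  -- + b‖ ≤ (2 - δ)‖a‖, hence 2δ‖a‖ ≤ 5κ. The left side is at least δε, and the factor 10 makes the
  -- right side at most δε / 2.
  set κ : ℝ := min (ε / 2) (δ * ε / 10) with hκdef
  have hκ : 0 < κ := lt_min (by positivity) (by positivity)
  have hκ1 : κ ≤ ε / 2 := min_le_left _ _
  have hκ2 : κ ≤ δ * ε / 10 := min_le_right _ _
  suffices W : ∀ a b : E, ‖a‖ ≤ R → ‖b‖ ≤ ‖a‖ →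
      2 * (‖a‖ ^ 2 + ‖b‖ ^ 2) - κ ^ 2 ≤ ‖a + b‖ ^ 2 → ‖a - b‖ < ε by
    refine ⟨κ ^ 2, by positivity, fun a b ha hb h => ?_⟩
    rcases le_total ‖b‖ ‖a‖ with hab | hab
    · exact W a b ha hab h
    · rw [norm_sub_rev]
      refine W b a hb hab ?_
      rw [add_comm b a]
      linarith
  intro a b ha hab h
  by_contra! hlt
  have hs : ε / 2 ≤ ‖a‖ := by linarith [norm_sub_le a b]
  have hs0 : 0 < ‖a‖ := by linarith
  have hsR : ‖a‖ ≤ max R 1 := ha.trans (le_max_left _ _)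
  have hnorm : ∀ c : E, ‖‖a‖⁻¹ • c‖ = ‖c‖ / ‖a‖ := fun c => by
    rw [norm_smul, norm_inv, norm_norm, inv_mul_eq_div]
  have h1 : ‖a + b‖ ≤ 2 * ‖a‖ - δ * ‖a‖ := by
    have := H (x := ‖a‖⁻¹ • a) (by rw [hnorm, div_self hs0.ne'])
      (y := ‖a‖⁻¹ • b) (by rw [hnorm]; exact (div_le_one hs0).2 hab)
      (by rw [← smul_sub, hnorm]
          exact div_le_div₀ (norm_nonneg _) hlt hs0 hsR)
    rw [← smul_add, hnorm, div_le_iff₀ hs0] at this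
    linarith
  have h2 : ‖a + b‖ ≤ ‖a‖ + ‖b‖ := norm_add_le a b
  have hb0 := norm_nonneg b
  have hN0 := norm_nonneg (a + b)
  have h3 : ‖a‖ - ‖b‖ ≤ κ := by
    refine abs_le_of_sq_le_sq' ?_ hκ.le |>.2
    nlinarith
  have h4 : ‖a + b‖ ^ 2 ≤ (2 * ‖a‖ - δ * ‖a‖) * (2 * ‖a‖) := by
    rw [sq]
    exact mul_le_mul h1 (by linarith) hN0 (hN0.trans h1)
  have h5 : ‖a‖ ^ 2 - 2 * ‖a‖ * κ ≤ ‖b‖ ^ 2 := by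
    nlinarith [sq_nonneg (‖a‖ - ‖b‖), mul_le_mul_of_nonneg_left h3 hs0.le]
  have h6 : κ * κ ≤ ‖a‖ * κ := mul_le_mul_of_nonneg_right (hκ1.trans hs) hκ.le
  have h7 : ‖a‖ * (2 * δ * ‖a‖) ≤ ‖a‖ * (5 * κ) := by nlinarith
  have h8 := le_of_mul_le_mul_left h7 hs0
  nlinarith [mul_le_mul_of_nonneg_left hs hδ.le, mul_pos hδ hε]

/-- Evaluating Jb at a + b bounds ‖a + b‖ from below, so the parallelogram defect of a and b is at
most 2φ(a, b). -/
theorem exists_norm_sub_lt_of_phi {ε : ℝ} (hε : 0 < ε) (R : ℝ) :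
    ∃ η > 0, ∀ a b : E, ‖a‖ ≤ R → ‖b‖ ≤ R → phi a b < η → ‖a - b‖ < ε := by
  obtain ⟨η, hη, H⟩ := exists_norm_sub_lt (E := E) hε R
  refine ⟨η / 2, by linarith, fun a b ha hb h => H a b ha hb ?_⟩
  have h1 := J_apply_le b (a + b)
  rw [map_add, J_apply_self] at h1
  unfold phi at h
  nlinarith [sq_nonneg (2 * ‖b‖ - ‖a + b‖)]

theorem tendsto_sub_of_phi {a b : ℕ → E} {R : ℝ} (hR : ∀ n, ‖a n‖ ≤ R ∨ ‖b n‖ ≤ R)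
    (h : Tendsto (fun n => phi (a n) (b n)) atTop (𝓝 0)) :
    Tendsto (fun n => a n - b n) atTop (𝓝 0) := by
  rw [Metric.tendsto_nhds]
  intro ε hε
  obtain ⟨η, hη, H⟩ := exists_norm_sub_lt_of_phi (E := E) hε (R + 1)
  filter_upwards [h.eventually_lt_const hη, h.eventually_lt_const one_pos] with n h1 h2
  have h3 : |‖a n‖ - ‖b n‖| ≤ 1 := by
    rw [abs_le]
    refine abs_le_of_sq_le_sq' ?_ zero_le_one
    linarith [sq_norm_sub_le_phi (a n) (b n)]
  obtain ⟨h4, h5⟩ := abs_le.1 h3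
  rw [dist_zero_right]
  rcases hR n with h6 | h6 <;> exact H _ _ (by linarith) (by linarith) h1

variable [CompleteSpace E]

/-- A downward directed family of closed convex sets that all meet a fixed ball has a common
point. -/
theorem exists_forall_mem_of_directed {ι : Type*} [Nonempty ι] {A : ι → Set E}
    (hdir : Directed (· ⊇ ·) A) (hcl : ∀ i, IsClosed (A i)) (hcv : ∀ i, Convex ℝ (A i)) {R : ℝ}
    (hR : ∀ i, ∃ a ∈ A i, ‖a‖ ≤ R) : ∃ p, ∀ i, p ∈ A i := by
  have hne : ∀ i, (A i).Nonempty := fun i => (hR i).imp fun a ha => ha.1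
  set D : ι → ℝ := fun i => Metric.infDist 0 (A i) with hD
  have hDle : ∀ i, ∀ a ∈ A i, D i ≤ ‖a‖ := fun i a ha => by
    simpa [hD] using Metric.infDist_le_dist_of_mem (x := (0 : E)) ha
  have hD0 : ∀ i, 0 ≤ D i := fun i => Metric.infDist_nonneg
  have hDR : ∀ i, D i ≤ R := fun i => by
    obtain ⟨a, ha, haR⟩ := hR i
    exact (hDle i a ha).trans haR
  have hbdd : BddAbove (Set.range D) := ⟨R, by rintro _ ⟨i, rfl⟩; exact hDR i⟩
  -- These are the nearly norm-minimal points of each set, measured against the supremum of the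
  -- distances to 0. They form a Cauchy filter base, whose limit is the common point.
  set B : ι × ℕ → Set E := fun q => A q.1 ∩ Metric.ball 0 ((⨆ i, D i) + 1 / ((q.2 : ℝ) + 1))
    with hB
  have hBdir : Directed (· ⊇ ·) B := by
    rintro ⟨i, m⟩ ⟨j, n⟩
    obtain ⟨k, hki, hkj⟩ := hdir i j
    refine ⟨(k, max m n), ?_, ?_⟩
    · refine Set.inter_subset_inter hki (Metric.ball_subset_ball ?_)
      have : (m : ℝ) ≤ (max m n : ℕ) := by exact_mod_cast le_max_left m n
      gcongr
    · refine Set.inter_subset_inter hkj (Metric.ball_subset_ball ?_)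
      have : (n : ℝ) ≤ (max m n : ℕ) := by exact_mod_cast le_max_right m n
      gcongr
  have hBne : ∀ q, (B q).Nonempty := by
    rintro ⟨i, n⟩
    have hlt : D i < (⨆ i, D i) + 1 / ((n : ℝ) + 1) :=
      (le_ciSup hbdd i).trans_lt (lt_add_of_pos_right _ Nat.one_div_pos_of_nat)
    obtain ⟨a, ha, hlt⟩ := (Metric.infDist_lt_iff (hne i)).1 hlt
    exact ⟨a, ha, by rwa [Metric.mem_ball']⟩
  have hCauchy : Cauchy (⨅ q, 𝓟 (B q)) := by
    refine Metric.cauchy_iff.2 ⟨iInf_neBot_of_directed' (fun q r => ?_) fun q =>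
      principal_neBot_iff.2 (hBne q), fun ε hε => ?_⟩
    · obtain ⟨s, h1, h2⟩ := hBdir q r
      exact ⟨s, principal_mono.2 h1, principal_mono.2 h2⟩
    obtain ⟨η, hη, H⟩ := exists_norm_sub_lt (E := E) hε (R + 1)
    have hR0 : 0 ≤ R := (hD0 (Classical.arbitrary ι)).trans (hDR _)
    -- Points of `B (i, n)` have norm below D i + 2κ and their midpoint has norm at least D i, so
    -- their parallelogram defect is at most 16(R + 1)κ < η.
    obtain ⟨n, hn⟩ := exists_nat_one_div_lt (show 0 < η / (16 * (R + 1)) by positivity)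
    have hn1 : 1 / ((n : ℝ) + 1) ≤ 1 := by
      rw [div_le_one (by positivity)]
      linarith [n.cast_nonneg (α := ℝ)]
    set κ : ℝ := 1 / ((n : ℝ) + 1) with hκ
    have hκ0 : 0 < κ := Nat.one_div_pos_of_nat
    obtain ⟨i, hi⟩ := exists_lt_of_lt_ciSup (show (⨆ i, D i) - κ < ⨆ i, D i by linarith)
    refine ⟨B (i, n), mem_iInf_of_mem (i, n) (mem_principal_self _), fun a ha b hb => ?_⟩
    have hsup : (⨆ i, D i) ≤ R := ciSup_le hDR
    have ha2 := mem_ball_zero_iff.1 ha.2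
    have hb2 := mem_ball_zero_iff.1 hb.2
    have hmid := hDle i _ (hcv i ha.1 hb.1 (show (0 : ℝ) ≤ 1 / 2 by norm_num)
      (show (0 : ℝ) ≤ 1 / 2 by norm_num) (by norm_num))
    rw [← smul_add, norm_smul, Real.norm_of_nonneg (by norm_num)] at hmid
    rw [dist_eq_norm]
    simp only at ha2 hb2
    have hD0i := hD0 i
    have hDRi := hDR i
    rw [lt_div_iff₀ (by positivity)] at hn
    have hsq : ∀ c : E, ‖c‖ < D i + 2 * κ → ‖c‖ ^ 2 ≤ D i ^ 2 + 4 * R * κ + 4 * κ := fun c hc => by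
      nlinarith [norm_nonneg c]
    refine H a b (by linarith) (by linarith) ?_
    nlinarith [hsq a (by linarith), hsq b (by linarith), norm_nonneg (a + b)]
  obtain ⟨p, hp⟩ := CompleteSpace.complete hCauchy
  have := hCauchy.1
  refine ⟨p, fun i => (hcl i).mem_of_tendsto (tendsto_id'.2 hp) ?_⟩
  exact mem_of_superset (mem_iInf_of_mem (i, 0) (mem_principal_self _)) Set.inter_subset_left

theorem exists_forall_norm_sq_sub_le {K : Set E} (hne : K.Nonempty) (hcl : IsClosed K)
    (hcv : Convex ℝ K) (g : StrongDual ℝ E) :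
    ∃ p ∈ K, ∀ z ∈ K, ‖p‖ ^ 2 - g p ≤ ‖z‖ ^ 2 - g z := by
  set G : E → ℝ := fun z => ‖z‖ ^ 2 - g z with hG
  have hg : ∀ z, g z ≤ ‖g‖ * ‖z‖ := fun z => (le_abs_self _).trans (g.le_opNorm z)
  have hGcont : Continuous G := by fun_prop
  have hbdd : BddBelow (G '' K) := by
    refine ⟨-(‖g‖ ^ 2), ?_⟩
    rintro _ ⟨z, -, rfl⟩
    simp only [hG]
    nlinarith [hg z, sq_nonneg (‖z‖ - ‖g‖ / 2)]
  set m := sInf (G '' K) with hm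
  have hle : ∀ z ∈ K, m ≤ G z := fun z hz => csInf_le hbdd ⟨z, hz, rfl⟩
  -- A minimizer is a common point of the nested sublevel sets; these meet a fixed ball because the
  -- quadratic term dominates g.
  set A : ℕ → Set E := fun n => K ∩ {z | G z ≤ m + 1 / ((n : ℝ) + 1)} with hA
  have hanti : Antitone A := by
    intro n k hnk
    refine Set.inter_subset_inter_right K fun z hz => ?_
    refine le_trans (Set.mem_ofPred.1 hz) ?_
    gcongr
  obtain ⟨p, hp⟩ := exists_forall_mem_of_directed (A := A) (R := ‖g‖ + |m| + 2)
    (hanti.directed_ge) (fun n => hcl.inter (isClosed_le hGcont continuous_const))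
    (fun n => hcv.inter (by
      have := (convexOn_norm_sq_sub g).convex_le (m + 1 / ((n : ℝ) + 1))
      simpa only [Set.mem_univ, true_and] using this))
    (fun n => by
      have hlt : m < m + 1 / ((n : ℝ) + 1) := lt_add_of_pos_right _ Nat.one_div_pos_of_nat
      obtain ⟨_, ⟨z, hz, rfl⟩, hzlt⟩ := exists_lt_of_csInf_lt (hne.image G) hlt
      refine ⟨z, ⟨hz, hzlt.le⟩, ?_⟩
      have hn1 : 1 / ((n : ℝ) + 1) ≤ 1 := by
        rw [div_le_one (by positivity)]
        linarith [n.cast_nonneg (α := ℝ)]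
      simp only [hG] at hzlt
      by_contra! hlt
      nlinarith [hg z, le_abs_self m, abs_nonneg m, norm_nonneg g])
  refine ⟨p, (hp 0).1, fun z hz => le_trans ?_ (hle z hz)⟩
  refine le_of_forall_pos_le_add fun ε hε => ?_
  obtain ⟨n, hn⟩ := exists_nat_one_div_lt hε
  have := (hp n).2
  simp only [Set.mem_ofPred, hG] at this
  linarith

theorem exists_isGenProj {K : Set E} (hne : K.Nonempty) (hcl : IsClosed K)
    (hcv : Convex ℝ K) (y : E) : ∃ p, IsGenProj K y p := by
  obtain ⟨p, hp, h⟩ := exists_forall_norm_sq_sub_le hne hcl hcv ((2 : ℝ) • J y)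
  refine ⟨p, hp, fun z hz => ?_⟩
  have := h z hz
  simp only [smul_apply, smul_eq_mul] at this
  unfold phi
  linarith

end UniformConvexity

/-! ### Uniform smoothness: differentiability of the norm, surjectivity and continuity of `J` -/

section UniformSmoothness

variable {E : Type*} [NormedAddCommGroup E] [NormedSpace ℝ E]

theorem norm_add_add_norm_sub_le_modulus {E : Type*} [NormedAddCommGroup E] {x y : E} (hx : ‖x‖ = 1) :
    (‖x + y‖ + ‖x - y‖) / 2 - 1 ≤ modulusOfSmoothness E ‖y‖ := by
  refine le_csSup ⟨‖y‖, ?_⟩ ⟨x, y, hx, rfl, rfl⟩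
  rintro _ ⟨a, b, ha, hb, rfl⟩
  linarith [norm_add_le a b, norm_sub_le a b]

/-- In a uniformly smooth space `J x` is the Gateaux derivative of `‖·‖² / 2` at `x`. -/
theorem eventually_norm_sq_add_smul_le (hE : UniformlySmooth E) (x h : E) {ε : ℝ} (hε : 0 < ε) :
    ∀ᶠ t : ℝ in 𝓝[>] 0, ‖x + t • h‖ ^ 2 ≤ ‖x‖ ^ 2 + 2 * t * J x h + t * ε := by
  have hsmall : ∀ c : ℝ, ∀ δ > 0, ∀ᶠ t : ℝ in 𝓝[>] 0, t * c < δ := fun c δ hδ => by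
    have : Tendsto (fun t : ℝ => t * c) (𝓝[>] 0) (𝓝 (0 * c)) :=
      ((continuous_id.mul continuous_const).tendsto 0).mono_left nhdsWithin_le_nhds
    rw [zero_mul] at this
    exact this.eventually_lt_const hδ
  rcases eq_or_ne h 0 with rfl | hh
  · filter_upwards [self_mem_nhdsWithin] with t ht
    have : 0 < t * ε := mul_pos ht hε
    simp [this.le]
  have hh0 : 0 < ‖h‖ := norm_pos_iff.2 hh
  rcases eq_or_ne x 0 with rfl | hx
  · have hJ : J (0 : E) = 0 := by rw [← norm_eq_zero, norm_J, norm_zero]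
    filter_upwards [self_mem_nhdsWithin, hsmall (‖h‖ ^ 2) ε hε] with t ht h1
    have ht0 : 0 < t := ht
    simp only [hJ, zero_add, norm_zero, norm_smul, Real.norm_of_nonneg ht0.le,
      zero_apply]
    nlinarith
  set a := ‖x‖ with ha
  have ha0 : 0 < a := norm_pos_iff.2 hx
  -- Smoothness bounds ‖x + th‖ + ‖x - th‖ and Jx bounds ‖x - th‖ from below, so ‖x + th‖ ≤ a + tc.
  -- After squaring, the κ term costs exactly tε / 2; the other half of ε absorbs t²c².
  set κ : ℝ := ε / (8 * a * ‖h‖) with hκ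
  have hκ0 : 0 < κ := by positivity
  set c : ℝ := J x h / a + 2 * κ * ‖h‖ with hc
  have hτ : Tendsto (fun t : ℝ => t * (‖h‖ / a)) (𝓝[>] 0) (𝓝[>] 0) := by
    refine tendsto_nhdsWithin_iff.2 ⟨?_, ?_⟩
    · have : Tendsto (fun t : ℝ => t * (‖h‖ / a)) (𝓝[>] 0) (𝓝 (0 * (‖h‖ / a))) :=
        ((continuous_id.mul continuous_const).tendsto 0).mono_left nhdsWithin_le_nhds
      rwa [zero_mul] at this
    · filter_upwards [self_mem_nhdsWithin] with t ht
      exact mul_pos (Set.mem_Ioi.1 ht) (by positivity)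
  filter_upwards [self_mem_nhdsWithin, hτ.eventually (hE.eventually_lt_const hκ0),
    hsmall (c ^ 2) (ε / 2) (by positivity)] with t ht h1 h2
  have ht0 : 0 < t := ht
  have hτ0 : 0 < t * (‖h‖ / a) := by positivity
  rw [div_lt_iff₀ hτ0] at h1
  have hnorm : ‖(t / a) • h‖ = t * (‖h‖ / a) := by
    rw [norm_smul, Real.norm_of_nonneg (by positivity)]
    ring
  have h3 := norm_add_add_norm_sub_le_modulus (x := a⁻¹ • x) (y := (t / a) • h)
    (by rw [norm_smul, norm_inv, norm_norm, inv_mul_cancel₀ ha0.ne'])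
  have h4 : a⁻¹ • x + (t / a) • h = a⁻¹ • (x + t • h) := by
    rw [smul_add, smul_smul, div_eq_inv_mul]
  have h5 : a⁻¹ • x - (t / a) • h = a⁻¹ • (x - t • h) := by
    rw [smul_sub, smul_smul, div_eq_inv_mul]
  have hai : ∀ z : E, ‖a⁻¹ • z‖ = ‖z‖ / a := fun z => by
    rw [norm_smul, norm_inv, norm_norm, inv_mul_eq_div]
  rw [hnorm, h4, h5, hai, hai] at h3
  have h6 := h3.trans h1.le
  have h7 : ‖x + t • h‖ + ‖x - t • h‖ ≤ 2 * a + 2 * κ * t * ‖h‖ := by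
    have h8 : ((‖x + t • h‖ / a + ‖x - t • h‖ / a) / 2 - 1) * (2 * a)
        ≤ κ * (t * (‖h‖ / a)) * (2 * a) := mul_le_mul_of_nonneg_right h6 (by positivity)
    have e1 : ((‖x + t • h‖ / a + ‖x - t • h‖ / a) / 2 - 1) * (2 * a)
        = ‖x + t • h‖ + ‖x - t • h‖ - 2 * a := by field_simp
    have e2 : κ * (t * (‖h‖ / a)) * (2 * a) = 2 * κ * t * ‖h‖ := by field_simp
    linarith
  have h9 : a - t * (J x h / a) ≤ ‖x - t • h‖ := by
    have := J_apply_le x (x - t • h)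
    rw [map_sub, map_smul, J_apply_self, smul_eq_mul, ← ha] at this
    refine le_of_mul_le_mul_left (le_trans (le_of_eq ?_) this) ha0
    field_simp
  have h10 : ‖x + t • h‖ ≤ a + t * c := by
    rw [hc]
    linarith
  have h11 : ‖x + t • h‖ ^ 2 ≤ (a + t * c) ^ 2 := pow_le_pow_left₀ (norm_nonneg _) h10 2
  have h12 : 2 * a * (t * c) = 2 * t * J x h + t * (ε / 2) := by
    rw [hc, hκ]
    field_simp
    ring
  nlinarith

/-- The first-order condition: b is compared with the one-sided derivative of ‖·‖² / 2 at x in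
direction h. -/
theorem le_J_apply_of_minimal (hE : UniformlySmooth E) {x h : E} {b : ℝ}
    (H : ∀ᶠ t : ℝ in 𝓝[>] 0, ‖x‖ ^ 2 + 2 * t * b ≤ ‖x + t • h‖ ^ 2) : b ≤ J x h := by
  refine le_of_forall_pos_le_add fun ε hε => ?_
  obtain ⟨t, ⟨h1, h2⟩, ht⟩ :=
    ((H.and (eventually_norm_sq_add_smul_le hE x h hε)).and self_mem_nhdsWithin).exists
  have ht0 : 0 < t := ht
  have h3 : t * (2 * b) ≤ t * (2 * J x h + ε) := by linarith
  have := le_of_mul_le_mul_left h3 ht0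
  linarith

/-- A minimizer of ‖z‖² - 2g(z) over the whole space has Euler equation Jx = g. -/
theorem J_surjective [UniformConvexSpace E] [CompleteSpace E] (hE : UniformlySmooth E) :
    Function.Surjective (J : E → StrongDual ℝ E) := by
  intro g
  obtain ⟨x, -, hx⟩ := exists_forall_norm_sq_sub_le Set.univ_nonempty isClosed_univ
    (convex_univ (E := E)) ((2 : ℝ) • g)
  have hle : ∀ h, g h ≤ J x h := fun h => by
    refine le_J_apply_of_minimal hE (Eventually.of_forall fun t => ?_)
    have := hx (x + t • h) trivial
    simp only [smul_apply, smul_eq_mul, map_add, map_smul] at this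
    linarith
  refine ⟨x, ContinuousLinearMap.ext fun h => le_antisymm ?_ (hle h)⟩
  have := hle (-h)
  rw [map_neg, map_neg] at this
  linarith

/-- For a fixed small t, the difference quotient at p nearly equals Jp h, while at b_n it bounds
J(b_n) h from above. Letting n grow, for h and for -h, gives both bounds. -/
theorem tendsto_J_apply (hE : UniformlySmooth E) {b : ℕ → E} {p : E}
    (hb : Tendsto b atTop (𝓝 p)) (h : E) : Tendsto (fun n => J (b n) h) atTop (𝓝 (J p h)) := by
  have key : ∀ h : E, ∀ ε > 0, ∀ᶠ n in atTop, J (b n) h < J p h + ε := fun h ε hε => by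
    obtain ⟨t, h1, ht⟩ :=
      ((eventually_norm_sq_add_smul_le hE p h hε).and self_mem_nhdsWithin).exists
    have ht0 : 0 < t := ht
    have hlim : Tendsto (fun n => ‖b n + t • h‖ ^ 2 - ‖b n‖ ^ 2) atTop
        (𝓝 (‖p + t • h‖ ^ 2 - ‖p‖ ^ 2)) :=
      ((hb.add_const _).norm.pow 2).sub (hb.norm.pow 2)
    have hlt : ‖p + t • h‖ ^ 2 - ‖p‖ ^ 2 < 2 * t * J p h + 2 * t * ε := by nlinarith [mul_pos ht0 hε]
    filter_upwards [hlim.eventually_lt_const hlt] with n hn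
    have h2 := norm_sq_add_le (b n) h t
    have h3 : 2 * t * J (b n) h < 2 * t * (J p h + ε) := by linarith
    exact lt_of_mul_lt_mul_left h3 (by positivity)
  rw [Metric.tendsto_nhds]
  intro ε hε
  filter_upwards [key h ε hε, key (-h) ε hε] with n h1 h2
  rw [map_neg, map_neg] at h2
  rw [Real.dist_eq, abs_lt]
  constructor <;> linarith

theorem tendsto_phi (hE : UniformlySmooth E) {b : ℕ → E} {p : E}
    (hb : Tendsto b atTop (𝓝 p)) (q : E) :
    Tendsto (fun n => phi q (b n)) atTop (𝓝 (phi q p)) :=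
  (tendsto_const_nhds.sub ((tendsto_J_apply hE hb q).const_mul 2)).add (hb.norm.pow 2)

end UniformSmoothness

/-! ### Limits under lower semicontinuity -/

section Semicontinuity

variable {E : Type*} [NormedAddCommGroup E] {C : Set E}

theorem le_of_tendsto_of_lowerSemicontinuousOn {g : E → ℝ} (hg : LowerSemicontinuousOn g C)
    {u : ℕ → E} {p : E} (hp : p ∈ C) (hu : ∀ n, u n ∈ C) (hup : Tendsto u atTop (𝓝 p))
    {b : ℕ → ℝ} {c : ℝ} (hb : Tendsto b atTop (𝓝 c)) (hle : ∀ n, g (u n) ≤ b n) : g p ≤ c := by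
  refine le_of_forall_lt fun a ha => ?_
  obtain ⟨a', h1, h2⟩ := exists_between ha
  refine h1.trans_le (ge_of_tendsto hb ?_)
  have hw : Tendsto u atTop (𝓝[C] p) := tendsto_nhdsWithin_iff.2 ⟨hup, Eventually.of_forall hu⟩
  filter_upwards [hw.eventually (hg p hp a' h2)] with n hn
  exact hn.le.trans (hle n)

theorem isClosed_sublevel {g : E → ℝ} (hg : LowerSemicontinuousOn g C) (hC : IsClosed C) (c : ℝ) :
    IsClosed {u | u ∈ C ∧ g u ≤ c} := by
  refine IsSeqClosed.isClosed fun u p hu hup => ?_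
  have hp := hC.mem_of_tendsto hup (Eventually.of_forall fun n => (hu n).1)
  exact ⟨hp, le_of_tendsto_of_lowerSemicontinuousOn hg hp (fun n => (hu n).1) hup
    tendsto_const_nhds fun n => (hu n).2⟩

end Semicontinuity

/-! ### Equilibrium problems and their resolvents -/

section Equilibrium

variable {E : Type*} [NormedAddCommGroup E] [NormedSpace ℝ E] {C : Set E}

/-- A convex lower semicontinuous function decreases at most linearly. -/
theorem exists_sub_mul_norm_le {g : E → ℝ} (hg : LowerSemicontinuousOn g C)
    (hcv : ConvexOn ℝ C g) {z : E} (hz : z ∈ C) :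
    ∃ M : ℝ, 0 ≤ M ∧ ∀ u ∈ C, g z - 1 - M * ‖u - z‖ ≤ g u := by
  obtain ⟨δ, hδ, H⟩ := Metric.mem_nhdsWithin_iff.1 (hg z hz (g z - 1) (by linarith))
  refine ⟨2 / δ, by positivity, fun u hu => ?_⟩
  rcases lt_or_ge ‖u - z‖ δ with hlt | hge
  · have : g z - 1 < g u := H ⟨by rwa [Metric.mem_ball, dist_eq_norm], hu⟩
    have : 0 ≤ 2 / δ * ‖u - z‖ := by positivity
    linarith
  have hn : 0 < ‖u - z‖ := hδ.trans_le hge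
  -- This t puts the point of the segment from z to u at distance δ / 2 from z, where semicontinuity
  -- applies; convexity carries the bound out to u.
  set t : ℝ := δ / (2 * ‖u - z‖) with ht
  have ht0 : 0 < t := by positivity
  have ht1 : t ≤ 1 := by
    rw [ht, div_le_one (by positivity)]
    linarith
  have hmem : (1 - t) • z + t • u ∈ C := hcv.1 hz hu (by linarith) ht0.le (by ring)
  have hdist : (1 - t) • z + t • u - z = t • (u - z) := by
    rw [sub_smul, smul_sub, one_smul]
    abel
  have h1 : g z - 1 < g ((1 - t) • z + t • u) := by
    refine H ⟨?_, hmem⟩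
    rw [Metric.mem_ball, dist_eq_norm, hdist, norm_smul, Real.norm_of_nonneg ht0.le, ht]
    have : δ / (2 * ‖u - z‖) * ‖u - z‖ = δ / 2 := by field_simp
    linarith
  have h2 := hcv.2 hz hu (by linarith : 0 ≤ 1 - t) ht0.le (by ring)
  rw [smul_eq_mul, smul_eq_mul] at h2
  have h3 : t * (2 / δ * ‖u - z‖) = 1 := by
    rw [ht]
    field_simp
  refine le_of_mul_le_mul_left ?_ ht0
  nlinarith

namespace EquilibriumConditions

variable {f : E → E → ℝ}

/-- Minty's lemma. -/
theorem mem_EP_of_forall_le (hf : EquilibriumConditions C f) (hC : Convex ℝ C) {p : E}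
    (hp : p ∈ C) (H : ∀ z ∈ C, f z p ≤ 0) : p ∈ EP C f := by
  refine ⟨hp, fun z hz => ?_⟩
  by_contra! hlt
  -- If f(p, z) < 0, then f(z_t, z) < 0 at z_t = tz + (1 - t)p for small t, and convexity makes
  -- f(z_t, z_t) negative, against (A1).
  obtain ⟨t, ⟨h1, ht1⟩, ht⟩ := (((hf.hemicontinuous p hp z hz z hz 0 hlt).and
    (nhdsWithin_le_nhds (eventually_lt_nhds one_pos))).and self_mem_nhdsWithin).exists
  have ht0 : 0 < t := ht
  have hmem : t • z + (1 - t) • p ∈ C := hC hz hp ht0.le (by linarith) (by ring)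
  have h2 := (hf.convex _ hmem).2 hz hp ht0.le (by linarith : 0 ≤ 1 - t) (by ring)
  rw [hf.diag _ hmem, smul_eq_mul, smul_eq_mul] at h2
  nlinarith [H _ hmem]

/-- Convexity expands the sum into a double sum, which is nonpositive after symmetrizing in i and j
by monotonicity. -/
theorem sum_mul_le_zero (hf : EquilibriumConditions C f) {ι : Type*} [Fintype ι] {z : ι → E}
    (hz : ∀ i, z i ∈ C) {w : ι → ℝ} (hw : ∀ i, 0 ≤ w i) (hw1 : ∑ i, w i = 1) :
    ∑ i, w i * f (z i) (∑ j, w j • z j) ≤ 0 := by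
  have h1 : ∑ i, w i * f (z i) (∑ j, w j • z j) ≤ ∑ i, ∑ j, w i * (w j * f (z i) (z j)) := by
    refine Finset.sum_le_sum fun i _ => ?_
    rw [← Finset.mul_sum]
    refine mul_le_mul_of_nonneg_left ?_ (hw i)
    simpa using (hf.convex _ (hz i)).map_sum_le (fun j _ => hw j) hw1 fun j _ => hz j
  have h2 : ∑ i, ∑ j, w i * (w j * f (z i) (z j)) = ∑ i, ∑ j, w j * (w i * f (z j) (z i)) :=
    Finset.sum_comm
  have h3 : ∑ i, ∑ j, w i * (w j * f (z i) (z j)) + ∑ i, ∑ j, w j * (w i * f (z j) (z i)) ≤ 0 := by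
    simp only [← Finset.sum_add_distrib]
    refine Finset.sum_nonpos fun i _ => Finset.sum_nonpos fun j _ => ?_
    nlinarith [hf.monotone _ (hz i) _ (hz j), mul_nonneg (hw i) (hw j)]
  linarith

/-- If it failed, the constant vector ε could be separated from the open convex set of vectors
strictly above some (f(z_i, u))_i. The normalized separating weights give a barycentre of the z_i
that violates `sum_mul_le_zero`. -/
theorem exists_forall_lt (hf : EquilibriumConditions C f) (hne : C.Nonempty) (hC : Convex ℝ C)
    {ι : Type*} [Fintype ι] {z : ι → E} (hz : ∀ i, z i ∈ C) {ε : ℝ} (hε : 0 < ε) :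
    ∃ u ∈ C, ∀ i, f (z i) u < ε := by
  classical
  by_contra! hcon
  set V : Set (ι → ℝ) := {v | ∃ u ∈ C, ∀ i, f (z i) u < v i} with hV
  have hVconv : Convex ℝ V := by
    rintro v ⟨u, hu, hv⟩ v' ⟨u', hu', hv'⟩ a b ha hb hab
    refine ⟨a • u + b • u', hC hu hu' ha hb hab, fun i => ?_⟩
    refine ((hf.convex _ (hz i)).2 hu hu' ha hb hab).trans_lt ?_
    simp only [smul_eq_mul, Pi.add_apply, Pi.smul_apply]
    rcases ha.eq_or_lt with rfl | ha
    · have : b = 1 := by linarith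
      subst this
      simpa using hv' i
    · have h1 := mul_lt_mul_of_pos_left (hv i) ha
      have h2 := mul_le_mul_of_nonneg_left (hv' i).le hb
      linarith
  have hVopen : IsOpen V := by
    have : V = ⋃ u ∈ C, ⋂ i, {v : ι → ℝ | f (z i) u < v i} := by
      ext v
      simp [hV]
    rw [this]
    exact isOpen_biUnion fun u _ => isOpen_iInter_of_finite fun i =>
      isOpen_lt continuous_const (continuous_apply i)
  have hnot : (fun _ => ε) ∉ V := by
    rintro ⟨u, hu, h⟩
    obtain ⟨i, hi⟩ := hcon u hu
    exact (h i).not_ge hi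
  obtain ⟨g, hg⟩ := geometric_hahn_banach_open_point hVconv hVopen hnot
  set c : ι → ℝ := fun i => g (fun j => if i = j then 1 else 0) with hc
  have hgsum : ∀ v : ι → ℝ, g v = ∑ i, v i * c i := fun v => by
    simpa using LinearMap.pi_apply_eq_sum_univ (g : (ι → ℝ) →ₗ[ℝ] ℝ) v
  have hkey : ∀ u ∈ C, ∀ k : ι → ℝ, (∀ i, 0 < k i) → ∑ i, (f (z i) u + k i) * c i < ∑ i, ε * c i := by
    intro u hu k hk
    have := hg (fun i => f (z i) u + k i) ⟨u, hu, fun i => by linarith [hk i]⟩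
    rwa [hgsum, hgsum] at this
  obtain ⟨u₀, hu₀⟩ := hne
  have hcle : ∀ i, c i ≤ 0 := by
    intro i
    by_contra! hpos
    set S := ∑ i, ε * c i - ∑ i, (f (z i) u₀ + 1) * c i with hS
    -- The set is upward closed, so a positive coefficient could be exploited by raising coordinate
    -- i; this amount yields |S| < S.
    have h1 := hkey u₀ hu₀ (fun j => 1 + if i = j then |S| / c i else 0) fun j => by
      split_ifs <;> positivity
    simp only [← add_assoc, add_mul _ (ite _ _ _), Finset.sum_add_distrib, ite_mul, zero_mul,
      Finset.sum_ite_eq, Finset.mem_univ, if_true] at h1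
    rw [div_mul_cancel₀ _ hpos.ne'] at h1
    linarith [le_abs_self S]
  have hpos : ∀ u ∈ C, 0 < ∑ i, -c i * f (z i) u := by
    intro u hu
    have := hkey u hu (fun _ => ε) fun _ => hε
    simp only [add_mul, Finset.sum_add_distrib] at this
    have h2 : ∑ i, -c i * f (z i) u = -∑ i, f (z i) u * c i := by
      rw [← Finset.sum_neg_distrib]
      exact Finset.sum_congr rfl fun i _ => by ring
    linarith
  set Λ := ∑ i, -c i with hΛ
  have hΛ0 : 0 < Λ := by
    refine (Finset.sum_nonneg fun i _ => by linarith [hcle i]).lt_of_ne fun h0 => ?_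
    have h1 := (Finset.sum_eq_zero_iff_of_nonneg fun i _ => by linarith [hcle i]).1 h0.symm
    have h2 := hpos u₀ hu₀
    rw [Finset.sum_eq_zero fun i hi => by rw [h1 i hi, zero_mul]] at h2
    exact h2.false
  have hw0 : ∀ i, 0 ≤ -c i / Λ := fun i => div_nonneg (by linarith [hcle i]) hΛ0.le
  have hw1 : ∑ i, -c i / Λ = 1 := by rw [← Finset.sum_div, ← hΛ, div_self hΛ0.ne']
  have h1 := hf.sum_mul_le_zero hz hw0 hw1
  have h2 := hpos _ (hC.sum_mem (fun i _ => hw0 i) hw1 fun i _ => hz i)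
  simp only [div_mul_eq_mul_div _ Λ (f _ _), ← Finset.sum_div] at h1
  exact (div_pos h2 hΛ0).not_ge h1

/-- Existence of solutions of equilibrium problems that are coercive at one point. -/
theorem EP_nonempty [UniformConvexSpace E] [CompleteSpace E] (hf : EquilibriumConditions C f)
    (hcl : IsClosed C) (hC : Convex ℝ C) {z₀ : E} (hz₀ : z₀ ∈ C) {R : ℝ}
    (hR : ∀ u ∈ C, f z₀ u ≤ 1 → ‖u‖ ≤ R) : (EP C f).Nonempty := by
  classical
  -- A common point satisfies f(z, p) ≤ 0 for all z, which is Minty's condition. Inserting z₀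
  -- everywhere keeps the approximate solutions in the ball of radius R.
  set A : Finset C × ℕ → Set E := fun q =>
    {u | u ∈ C ∧ ∀ z ∈ insert ⟨z₀, hz₀⟩ q.1, f (z : C) u ≤ 1 / ((q.2 : ℝ) + 1)} with hA
  have hAeq : ∀ q, A q = ⋂ z ∈ insert ⟨z₀, hz₀⟩ q.1,
      {u | u ∈ C ∧ f (z : C) u ≤ 1 / ((q.2 : ℝ) + 1)} := fun q => by
    ext u
    simp only [hA, Set.mem_ofPred, Set.mem_iInter]
    exact ⟨fun h z hz => ⟨h.1, h.2 z hz⟩, fun h =>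
      ⟨(h _ (Finset.mem_insert_self _ _)).1, fun z hz => (h z hz).2⟩⟩
  have hanti : Antitone A := by
    rintro ⟨s, m⟩ ⟨t, n⟩ ⟨hst, hmn⟩ u ⟨hu, h⟩
    refine ⟨hu, fun z hz => (h z (Finset.insert_subset_insert _ hst hz)).trans ?_⟩
    simp only at hmn ⊢
    gcongr
  obtain ⟨p, hp⟩ := exists_forall_mem_of_directed (A := A) (R := R) hanti.directed_ge
    (fun q => by
      rw [hAeq]
      exact isClosed_biInter fun z _ => isClosed_sublevel (hf.lsc z z.2) hcl _)
    (fun q => by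
      rw [hAeq]
      exact convex_iInter₂ fun z _ => (hf.convex z z.2).convex_le _)
    (fun q => by
      have hε : 0 < 1 / ((q.2 : ℝ) + 1) := Nat.one_div_pos_of_nat
      obtain ⟨u, hu, h⟩ := hf.exists_forall_lt ⟨z₀, hz₀⟩ hC
        (z := fun z : (insert ⟨z₀, hz₀⟩ q.1 : Finset C) => ((z : C) : E)) (fun z => z.1.2) hε
      refine ⟨u, ⟨hu, fun z hz => (h ⟨z, hz⟩).le⟩, hR u hu ?_⟩
      refine (h ⟨_, Finset.mem_insert_self _ _⟩).le.trans ?_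
      rw [div_le_one (by positivity)]
      linarith [q.2.cast_nonneg (α := ℝ)])
  refine ⟨p, hf.mem_EP_of_forall_le hC (hp (∅, 0)).1 fun z hz => ?_⟩
  refine le_of_forall_pos_le_add fun ε hε => ?_
  obtain ⟨n, hn⟩ := exists_nat_one_div_lt hε
  have := (hp ({⟨z, hz⟩}, n)).2 ⟨z, hz⟩ (by simp)
  simp only at this
  linarith

/-- Adding the difference of a continuous convex function keeps the conditions (A1)-(A4). -/
theorem add_sub (hf : EquilibriumConditions C f) {ψ : E → ℝ} (hψ : Continuous ψ)
    (hcv : ConvexOn ℝ Set.univ ψ) :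
    EquilibriumConditions C fun x z => f x z + (ψ z - ψ x) where
  diag x hx := by simp [hf.diag x hx]
  monotone x hx y hy := by linarith [hf.monotone x hx y hy]
  hemicontinuous x hx y hy z hz a ha := by
    obtain ⟨b, hb1, hb2⟩ := exists_between (show f x y < a - (ψ y - ψ x) by linarith)
    have hcont : Continuous fun t : ℝ => ψ (t • z + (1 - t) • x) := by fun_prop
    have hlim := (hcont.tendsto 0).mono_left (nhdsWithin_le_nhds (s := Set.Ioi 0))
    simp only [zero_smul, sub_zero, one_smul, zero_add] at hlim
    filter_upwards [hf.hemicontinuous x hx y hy z hz b hb1,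
      hlim.eventually_const_lt (show ψ x - (a - (ψ y - ψ x) - b) < ψ x by linarith)] with t h1 h2
    linarith
  convex x hx := by
    have hC := (hf.convex x hx).1
    refine (hf.convex x hx).add ⟨hC, fun u hu v hv a b ha hb hab => ?_⟩
    have := hcv.2 (Set.mem_univ u) (Set.mem_univ v) ha hb hab
    simp only [smul_eq_mul] at this ⊢
    have e : a * ψ x + b * ψ x = ψ x := by rw [← add_mul, hab, one_mul]
    linarith
  lsc x hx := (hf.lsc x hx).add
    ((hψ.sub continuous_const : Continuous fun z => ψ z - ψ x).lowerSemicontinuous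
      |>.lowerSemicontinuousOn C)

/-- The resolvent of `f` is defined everywhere. -/
theorem exists_resolvent [UniformConvexSpace E] [CompleteSpace E] (hE : UniformlySmooth E)
    (hf : EquilibriumConditions C f) (hne : C.Nonempty) (hcl : IsClosed C) (hC : Convex ℝ C)
    {r : ℝ} (hr : 0 < r) (y : E) :
    ∃ u ∈ C, ∀ z ∈ C, 0 ≤ f u z + 1 / r * (J u - J y) (z - u) := by
  obtain ⟨z₀, hz₀⟩ := hne
  set g : StrongDual ℝ E := (2 : ℝ) • J y with hg
  -- The derivative of ψ at u is (Ju - Jy) / r, so the resolvent inequality is the first-order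
  -- condition for an equilibrium of f(u, z) + ψ(z) - ψ(u). Coercivity holds since ψ grows
  -- quadratically and f(z₀, ·) falls at most linearly.
  set ψ : E → ℝ := fun z => (1 / (2 * r)) * (‖z‖ ^ 2 - g z) with hψ
  have hψcont : Continuous ψ := by fun_prop
  have hψcv : ConvexOn ℝ Set.univ ψ := (convexOn_norm_sq_sub g).smul (by positivity)
  have hh := hf.add_sub hψcont hψcv
  obtain ⟨M, hM, hfM⟩ := exists_sub_mul_norm_le (hf.lsc z₀ hz₀) (hf.convex z₀ hz₀) hz₀
  have hcoercive : ∃ R, ∀ u ∈ C, f z₀ u + (ψ u - ψ z₀) ≤ 1 → ‖u‖ ≤ R := by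
    set b : ℝ := 2 * r * M + ‖g‖ with hb
    set c : ℝ := 2 * r * (2 + M * ‖z₀‖ + |ψ z₀|) with hc
    refine ⟨b + c + 1, fun u hu h => ?_⟩
    have h1 := hfM u hu
    rw [hf.diag z₀ hz₀] at h1
    have h2 : M * ‖u - z₀‖ ≤ M * (‖u‖ + ‖z₀‖) := mul_le_mul_of_nonneg_left (norm_sub_le _ _) hM
    have h3 : ψ u ≤ 2 + M * ‖z₀‖ + |ψ z₀| + M * ‖u‖ := by linarith [le_abs_self (ψ z₀)]
    have h4 : ‖u‖ ^ 2 - g u = 2 * r * ψ u := by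
      rw [hψ]
      field_simp
    have h5 : g u ≤ ‖g‖ * ‖u‖ := (le_abs_self _).trans (g.le_opNorm u)
    have h6 := mul_le_mul_of_nonneg_left h3 (show 0 ≤ 2 * r by positivity)
    have h7 : ‖u‖ ^ 2 ≤ b * ‖u‖ + c := by
      rw [hb, hc]
      linarith
    have hb0 : 0 ≤ b := by positivity
    have hc0 : 0 ≤ c := by positivity
    by_contra! hlt
    nlinarith [norm_nonneg u]
  obtain ⟨R, hR⟩ := hcoercive
  obtain ⟨u, hu, hmin⟩ := hh.EP_nonempty hcl hC hz₀ hR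
  refine ⟨u, hu, fun z hz => ?_⟩
  have hle : J y (z - u) - r * f u z ≤ J u (z - u) := by
    refine le_J_apply_of_minimal hE ?_
    filter_upwards [self_mem_nhdsWithin, nhdsWithin_le_nhds (eventually_lt_nhds one_pos)]
      with t ht ht1
    have ht0 : 0 < t := ht
    have heq : (1 - t) • u + t • z = u + t • (z - u) := by
      rw [sub_smul, smul_sub, one_smul]
      abel
    have h1 := hmin _ (hC hu hz (by linarith : 0 ≤ 1 - t) ht0.le (by ring))
    have h2 := (hf.convex u hu).2 hu hz (by linarith : 0 ≤ 1 - t) ht0.le (by ring)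
    rw [hf.diag u hu, smul_eq_mul, smul_eq_mul, mul_zero, zero_add] at h2
    rw [heq] at h1 h2
    have h3 : 0 ≤ t * f u z + (ψ (u + t • (z - u)) - ψ u) := by linarith
    have h4 : 2 * r * (t * f u z + (ψ (u + t • (z - u)) - ψ u))
        = 2 * r * (t * f u z) + (‖u + t • (z - u)‖ ^ 2 - ‖u‖ ^ 2 - 2 * t * J y (z - u)) := by
      simp only [hψ, hg, smul_apply, smul_eq_mul, map_add, map_smul]
      field_simp
      ring
    have h5 : 0 ≤ 2 * r * (t * f u z + (ψ (u + t • (z - u)) - ψ u)) := by positivity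
    linarith
  have h6 : f u z + 1 / r * (J u - J y) (z - u) = (r * f u z + (J u - J y) (z - u)) / r := by
    field_simp
  rw [h6, sub_apply]
  exact div_nonneg (by linarith) hr.le

end EquilibriumConditions

/-- Testing with z = q removes f, since f(u, q) ≤ -f(q, u) ≤ 0; the three-point identity
`phi_sub_sub` rewrites the remaining pairing. -/
theorem phi_add_phi_le_of_resolvent {f : E → E → ℝ} (hf : EquilibriumConditions C f) {r : ℝ}
    (hr : 0 < r) {u y q : E} (hu : u ∈ C)
    (h : ∀ z ∈ C, 0 ≤ f u z + 1 / r * (J u - J y) (z - u)) (hq : q ∈ EP C f) :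
    phi q u + phi u y ≤ phi q y := by
  have h1 := hf.monotone u hu q hq.1
  have h2 := hq.2 u hu
  have h3 : 0 ≤ 1 / r * (J u - J y) (q - u) := by linarith [h q hq.1]
  have h4 := nonneg_of_mul_nonneg_right h3 (one_div_pos.2 hr)
  linarith [phi_sub_sub u y q]

/-- Limits of resolvents `u n` of points `y n` are equilibria if `u` and `y` have the same limit. -/
theorem mem_EP_of_tendsto (hE : UniformlySmooth E) (hcl : IsClosed C) (hC : Convex ℝ C)
    {f : E → E → ℝ} (hf : EquilibriumConditions C f) {r : ℕ → ℝ} {c : ℝ} (hc : 0 < c)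
    (hr : ∀ n, c ≤ r n) {u y : ℕ → E} {p : E} (hu : ∀ n, u n ∈ C)
    (h : ∀ n, ∀ z ∈ C, 0 ≤ f (u n) z + 1 / r n * (J (u n) - J (y n)) (z - u n))
    (hup : Tendsto u atTop (𝓝 p)) (hyp : Tendsto y atTop (𝓝 p)) : p ∈ EP C f := by
  have hp : p ∈ C := hcl.mem_of_tendsto hup (Eventually.of_forall hu)
  refine hf.mem_EP_of_forall_le hC hp fun z hz => ?_
  have hJu : Tendsto (fun n => J (u n) (z - u n)) atTop (𝓝 (J p z - ‖p‖ ^ 2)) := by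
    simp only [map_sub, J_apply_self]
    exact (tendsto_J_apply hE hup z).sub (hup.norm.pow 2)
  -- Both the functional and its argument vary, and `J` is known to converge only pointwise.
  -- Splitting z - u_n through y_n leaves a remainder bounded by ‖y_n‖‖y_n - u_n‖.
  have hJy : Tendsto (fun n => J (y n) (z - u n)) atTop (𝓝 (J p z - ‖p‖ ^ 2)) := by
    have h1 : Tendsto (fun n => J (y n) z - ‖y n‖ ^ 2 + J (y n) (y n - u n)) atTop
        (𝓝 (J p z - ‖p‖ ^ 2 + 0)) := by
      refine ((tendsto_J_apply hE hyp z).sub (hyp.norm.pow 2)).add ?_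
      have h2 : Tendsto (fun n => ‖y n‖ * ‖y n - u n‖) atTop (𝓝 (‖p‖ * ‖p - p‖)) :=
        hyp.norm.mul (hyp.sub hup).norm
      rw [sub_self, norm_zero, mul_zero] at h2
      refine squeeze_zero_norm (fun n => ?_) h2
      exact ((J (y n)).le_opNorm _).trans_eq (by rw [norm_J])
    rw [add_zero] at h1
    refine h1.congr fun n => ?_
    simp only [map_sub, J_apply_self]
    ring
  have hlim := ((hJu.sub hJy).abs).const_mul (1 / c)
  rw [sub_self, abs_zero, mul_zero] at hlim
  refine le_of_tendsto_of_lowerSemicontinuousOn (hf.lsc z hz) hp hu hup hlim fun n => ?_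
  have h1 := hf.monotone _ (hu n) _ hz
  have h2 := h n z hz
  rw [sub_apply] at h2
  have h3 : 1 / r n * (J (u n) (z - u n) - J (y n) (z - u n))
      ≤ 1 / c * |J (u n) (z - u n) - J (y n) (z - u n)| := by
    refine (mul_le_mul_of_nonneg_left (le_abs_self _) ?_).trans
      (mul_le_mul_of_nonneg_right (one_div_le_one_div_of_le hc (hr n)) (abs_nonneg _))
    exact one_div_nonneg.2 (hc.le.trans (hr n))
  linarith

end Equilibrium

/-! ### The hybrid scheme -/

section Scheme

variable {E : Type*} [NormedAddCommGroup E] [NormedSpace ℝ E] {C : Set E} {f₁ f₂ : E → E → ℝ}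

/-- The terms ‖z‖² cancel, leaving a closed half-space. -/
theorem isClosed_convex_phi_le (w x : E) :
    IsClosed {z | phi z w ≤ phi z x} ∧ Convex ℝ {z | phi z w ≤ phi z x} := by
  have heq : {z | phi z w ≤ phi z x} = {z | (J x - J w) z ≤ (‖x‖ ^ 2 - ‖w‖ ^ 2) / 2} := by
    ext z
    simp only [phi, Set.mem_ofPred, sub_apply]
    constructor <;> intro h <;> linarith
  rw [heq]
  exact ⟨isClosed_le (J x - J w).continuous continuous_const,
    convex_halfSpace_le (J x - J w).toLinearMap.isLinear _⟩

/-- The decrease of `φ(q, ·)` in one step of the hybrid scheme. -/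
theorem phi_step_le (hf₁ : EquilibriumConditions C f₁) (hf₂ : EquilibriumConditions C f₂)
    {S : E → E} {q x y u v w : E} {a b r : ℝ} (hr : 0 < r) (ha : a ∈ Set.Ioo (0 : ℝ) 1)
    (hb : b ∈ Set.Ioo (0 : ℝ) 1) (hq₁ : q ∈ EP C f₁) (hq₂ : q ∈ EP C f₂)
    (hS : phi q (S x) ≤ phi q x)
    (hy : J y = a • J x + (1 - a) • J (S x))
    (hu : u ∈ C) (hu' : ∀ z ∈ C, 0 ≤ f₁ u z + 1 / r * (J u - J y) (z - u))
    (hv : v ∈ C) (hv' : ∀ z ∈ C, 0 ≤ f₂ v z + 1 / r * (J v - J y) (z - v))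
    (hw : J w = b • J u + (1 - b) • J v) :
    phi q w + (b * phi u y + (1 - b) * phi v y) + (a * phi y x + (1 - a) * phi y (S x))
      ≤ phi q x := by
  have h1 := phi_convexCombination hy q
  have h2 := phi_convexCombination hw q
  have h3 := phi_add_phi_le_of_resolvent hf₁ hr hu hu' hq₁
  have h4 := phi_add_phi_le_of_resolvent hf₂ hr hv hv' hq₂
  have h5 : 0 ≤ b * phi w u + (1 - b) * phi w v := add_nonneg
    (mul_nonneg hb.1.le (phi_nonneg _ _)) (mul_nonneg (by linarith [hb.2]) (phi_nonneg _ _))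
  have h6 := mul_le_mul_of_nonneg_left h3 hb.1.le
  have h7 := mul_le_mul_of_nonneg_left h4 (show 0 ≤ 1 - b by linarith [hb.2])
  have h8 := mul_le_mul_of_nonneg_left hS (show 0 ≤ 1 - a by linarith [ha.2])
  linarith

theorem phi_le_of_step (hf₁ : EquilibriumConditions C f₁) (hf₂ : EquilibriumConditions C f₂)
    {S : E → E} {q x y u v w : E} {a b r : ℝ} (hr : 0 < r) (ha : a ∈ Set.Ioo (0 : ℝ) 1)
    (hb : b ∈ Set.Ioo (0 : ℝ) 1) (hq₁ : q ∈ EP C f₁) (hq₂ : q ∈ EP C f₂)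
    (hS : phi q (S x) ≤ phi q x)
    (hy : J y = a • J x + (1 - a) • J (S x))
    (hu : u ∈ C) (hu' : ∀ z ∈ C, 0 ≤ f₁ u z + 1 / r * (J u - J y) (z - u))
    (hv : v ∈ C) (hv' : ∀ z ∈ C, 0 ≤ f₂ v z + 1 / r * (J v - J y) (z - v))
    (hw : J w = b • J u + (1 - b) • J v) : phi q w ≤ phi q x := by
  have h := phi_step_le hf₁ hf₂ hr ha hb hq₁ hq₂ hS hy hu hu' hv hv' hw
  have h1 : ∀ {c : ℝ}, c ∈ Set.Ioo (0 : ℝ) 1 → ∀ s t z : E, 0 ≤ c * phi s z + (1 - c) * phi t z :=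
    fun hc s t z => add_nonneg (mul_nonneg hc.1.le (phi_nonneg _ _))
      (mul_nonneg (by linarith [hc.2]) (phi_nonneg _ _))
  have h2 : 0 ≤ a * phi y x + (1 - a) * phi y (S x) := add_nonneg
    (mul_nonneg ha.1.le (phi_nonneg _ _)) (mul_nonneg (by linarith [ha.2]) (phi_nonneg _ _))
  linarith [h1 hb u v y]

variable [UniformConvexSpace E]

/-- Generalized projections of a point onto a decreasing sequence of convex sets with a common
point form a Cauchy sequence. -/
theorem cauchySeq_of_isGenProj {K : ℕ → Set E} (hanti : Antitone K) (hcv : ∀ n, Convex ℝ (K n))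
    {q x₀ : E} (hq : ∀ n, q ∈ K n) {x : ℕ → E} (hx : ∀ n, IsGenProj (K n) x₀ (x n)) :
    CauchySeq x := by
  have hmono : Monotone fun n => phi (x n) x₀ := fun m n hmn =>
    (hx m).2 _ (hanti hmn (hx n).1)
  have hle : ∀ n, phi (x n) x₀ ≤ phi q x₀ := fun n => (hx n).2 q (hq n)
  have hbound : ∀ n, ‖x n‖ ≤ ‖x₀‖ + phi q x₀ + 1 := fun n => by
    have := (sq_norm_sub_le_phi (x n) x₀).trans (hle n)
    nlinarith [sq_nonneg (‖x n‖ - ‖x₀‖ - 1), phi_nonneg q x₀]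
  have hlim := tendsto_atTop_ciSup hmono ⟨_, by rintro _ ⟨n, rfl⟩; exact hle n⟩
  rw [Metric.cauchySeq_iff']
  intro ε hε
  obtain ⟨η, hη, H⟩ := exists_norm_sub_lt (E := E) hε (‖x₀‖ + phi q x₀ + 1)
  obtain ⟨N, hN⟩ := Metric.cauchySeq_iff'.1 hlim.cauchySeq (η / 2) (by linarith)
  refine ⟨N, fun n hn => ?_⟩
  rw [dist_eq_norm]
  refine H _ _ (hbound n) (hbound N) ?_
  have h1 := hN n hn
  rw [Real.dist_eq, abs_lt] at h1
  -- The midpoint of x_n and x_N stays in K_N, so its φ is at least the minimum φ(x_N, x₀); the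
  -- parallelogram defect is then at most twice the gap between the two values of φ.
  have h2 := (hx N).2 _ (hcv N (hanti hn (hx n).1) (hx N).1 (show (0 : ℝ) ≤ 1 / 2 by norm_num)
      (show (0 : ℝ) ≤ 1 / 2 by norm_num) (by norm_num))
  rw [← smul_add] at h2
  have h3 : ‖(1 / 2 : ℝ) • (x n + x N)‖ ^ 2 = ‖x n + x N‖ ^ 2 / 4 := by
    rw [norm_smul, Real.norm_of_nonneg (by norm_num)]
    ring
  simp only [phi, h3, map_smul, map_add, smul_eq_mul] at h1 h2
  linarith

variable [CompleteSpace E]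

theorem exists_isHybridScheme (hE : UniformlySmooth E) (hcl : IsClosed C) (hC : Convex ℝ C)
    (hf₁ : EquilibriumConditions C f₁) (hf₂ : EquilibriumConditions C f₂)
    {S : ℕ → E → E} {F : Set E} (hFne : F.Nonempty)
    (hFC : F ⊆ C) (hF₁ : F ⊆ EP C f₁) (hF₂ : F ⊆ EP C f₂)
    (hFS : ∀ n, ∀ q ∈ F, ∀ x ∈ C, phi q (S n x) ≤ phi q x)
    {α r : ℕ → ℝ} {β : ℝ} (hr : ∀ n, 0 < r n) (hα : ∀ n, α n ∈ Set.Ioo (0 : ℝ) 1)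
    (hβ : β ∈ Set.Ioo (0 : ℝ) 1) {x₀ : E} (hx₀ : x₀ ∈ C) :
    ∃ (x y u v w : ℕ → E) (K : ℕ → Set E), x 0 = x₀ ∧
      IsHybridScheme C f₁ f₂ S α r β x y u v w K := by
  have hne : C.Nonempty := ⟨x₀, hx₀⟩
  -- The state is the pair (x_n, C_n) with its invariants; `F ⊆ s.2` keeps the next set nonempty, so
  -- the projection exists.
  let σ := {s : E × Set E // s.1 ∈ C ∧ IsClosed s.2 ∧ Convex ℝ s.2 ∧ F ⊆ s.2 ∧ s.2 ⊆ C}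
  have hstep : ∀ (n : ℕ) (s : σ), ∃ (y u v w : E) (s' : σ),
      J y = α n • J s.1.1 + (1 - α n) • J (S n s.1.1) ∧
      u ∈ C ∧ (∀ z ∈ C, 0 ≤ f₁ u z + 1 / r n * (J u - J y) (z - u)) ∧
      v ∈ C ∧ (∀ z ∈ C, 0 ≤ f₂ v z + 1 / r n * (J v - J y) (z - v)) ∧
      J w = β • J u + (1 - β) • J v ∧
      s'.1.2 = {z | z ∈ s.1.2 ∧ phi z w ≤ phi z s.1.1} ∧ IsGenProj s'.1.2 x₀ s'.1.1 := by
    rintro n ⟨⟨x, K⟩, hx, hKcl, hKcv, hFK, hKC⟩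
    obtain ⟨y, hy⟩ := J_surjective hE (α n • J x + (1 - α n) • J (S n x))
    obtain ⟨u, hu, hu'⟩ := hf₁.exists_resolvent hE hne hcl hC (hr n) y
    obtain ⟨v, hv, hv'⟩ := hf₂.exists_resolvent hE hne hcl hC (hr n) y
    obtain ⟨w, hw⟩ := J_surjective hE (β • J u + (1 - β) • J v)
    obtain ⟨hHcl, hHcv⟩ := isClosed_convex_phi_le w x
    have hcl' : IsClosed {z | z ∈ K ∧ phi z w ≤ phi z x} := hKcl.inter hHcl
    have hcv' : Convex ℝ {z | z ∈ K ∧ phi z w ≤ phi z x} := hKcv.inter hHcv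
    have hF' : F ⊆ {z | z ∈ K ∧ phi z w ≤ phi z x} := fun q hq => ⟨hFK hq,
      phi_le_of_step hf₁ hf₂ (hr n) (hα n) hβ (hF₁ hq) (hF₂ hq) (hFS n q hq x hx) hy hu hu' hv hv' hw⟩
    obtain ⟨x', hx'⟩ := exists_isGenProj (hFne.mono hF') hcl' hcv' x₀
    exact ⟨y, u, v, w, ⟨(x', _), hKC hx'.1.1, hcl', hcv', hF', fun z hz => hKC hz.1⟩,
      hy, hu, hu', hv, hv', hw, rfl, hx'⟩
  choose y u v w s' h using hstep
  let s : ℕ → σ := fun n => Nat.rec ⟨(x₀, C), hx₀, hcl, hC, hFC, subset_rfl⟩ s' n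
  refine ⟨fun n => (s n).1.1, fun n => y n (s n), fun n => u n (s n), fun n => v n (s n),
    fun n => w n (s n), fun n => (s n).1.2, rfl, ?_⟩
  exact
    { x_zero := hx₀
      K_zero := rfl
      y_eq := fun n => (h n (s n)).1
      u_mem := fun n => (h n (s n)).2.1
      u_ineq := fun n => (h n (s n)).2.2.1
      v_mem := fun n => (h n (s n)).2.2.2.1
      v_ineq := fun n => (h n (s n)).2.2.2.2.1
      w_eq := fun n => (h n (s n)).2.2.2.2.2.1
      K_succ := fun n => (h n (s n)).2.2.2.2.2.2.1
      x_succ := fun n => (h n (s n)).2.2.2.2.2.2.2 }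

theorem IsHybridScheme.exists_tendsto (hE : UniformlySmooth E) (hcl : IsClosed C)
    (hC : Convex ℝ C) (hf₁ : EquilibriumConditions C f₁) (hf₂ : EquilibriumConditions C f₂)
    {S : ℕ → E → E} {F : Set E} (hFne : F.Nonempty)
    (hFC : F ⊆ C) (hF₁ : F ⊆ EP C f₁) (hF₂ : F ⊆ EP C f₂)
    (hFS : ∀ n, ∀ q ∈ F, ∀ x ∈ C, phi q (S n x) ≤ phi q x)
    {α r : ℕ → ℝ} {β c : ℝ} (hc : 0 < c) (hr : ∀ n, c ≤ r n) (hα : ∀ n, α n ∈ Set.Ioo (0 : ℝ) 1)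
    (hβ : β ∈ Set.Ioo (0 : ℝ) 1) (hαlim : 0 < liminf (fun n => α n * (1 - α n)) atTop)
    {x y u v w : ℕ → E} {K : ℕ → Set E} (h : IsHybridScheme C f₁ f₂ S α r β x y u v w K) :
    ∃ p ∈ EP C f₁ ∩ EP C f₂, (∀ n, x n ∈ C) ∧ Tendsto x atTop (𝓝 p) ∧
      Tendsto (fun n => S n (x n)) atTop (𝓝 p) := by
  have hr0 : ∀ n, 0 < r n := fun n => hc.trans_le (hr n)
  have hanti : Antitone K := antitone_nat_of_succ_le fun n => by
    rw [h.K_succ]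
    exact fun z hz => hz.1
  have hKC : ∀ n, K n ⊆ C := fun n => (hanti n.zero_le).trans h.K_zero.subset
  have hxC : ∀ n, x n ∈ C := fun n => by
    cases n with
    | zero => exact h.x_zero
    | succ n => exact hKC _ (h.x_succ n).1
  have hKcv : ∀ n, Convex ℝ (K n) := fun n => by
    induction n with
    | zero => rwa [h.K_zero]
    | succ n ih =>
      rw [h.K_succ]
      exact ih.inter (isClosed_convex_phi_le _ _).2
  have hFK : ∀ n, F ⊆ K n := fun n => by
    induction n with
    | zero => rwa [h.K_zero]
    | succ n ih =>
      rw [h.K_succ]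
      exact fun q hq => ⟨ih hq, phi_le_of_step hf₁ hf₂ (hr0 n) (hα n) hβ (hF₁ hq) (hF₂ hq)
        (hFS n q hq _ (hxC n)) (h.y_eq n) (h.u_mem n) (h.u_ineq n) (h.v_mem n) (h.v_ineq n)
        (h.w_eq n)⟩
  obtain ⟨q, hq⟩ := hFne
  -- The scheme gives x_n as a projection only from index 1 on, hence the shift.
  have hcauchy : CauchySeq fun n => x (n + 1) :=
    cauchySeq_of_isGenProj (K := fun n => K (n + 1)) (fun m n hmn => hanti (by omega))
      (fun n => hKcv _) (fun n => hFK _ hq) h.x_succ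
  obtain ⟨p, hp⟩ := cauchySeq_tendsto_of_complete hcauchy
  have hxp : Tendsto x atTop (𝓝 p) := (tendsto_add_atTop_iff_nat 1).1 hp
  obtain ⟨R, hR⟩ := hxp.norm.bddAbove_range
  have hxR : ∀ n, ‖x n‖ ≤ R := fun n => hR ⟨n, rfl⟩
  have hφx : Tendsto (fun n => phi (x (n + 1)) (x n)) atTop (𝓝 0) := by
    have hlim := ((hp.norm.pow 2).sub (hxp.norm.pow 2)).add
      ((hxp.norm.mul (hp.sub hxp).norm).const_mul 2)
    simp only [sub_self, norm_zero, mul_zero, add_zero] at hlim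
    exact squeeze_zero (fun n => phi_nonneg _ _) (fun n => phi_le _ _) hlim
  have hφw : Tendsto (fun n => phi (x (n + 1)) (w n)) atTop (𝓝 0) :=
    squeeze_zero (fun n => phi_nonneg _ _) (fun n => by
      have := (h.x_succ n).1
      rw [h.K_succ] at this
      exact this.2) hφx
  have hwp : Tendsto w atTop (𝓝 p) := by
    simpa using hp.sub (tendsto_sub_of_phi (R := R) (fun n => Or.inl (hxR _)) hφw)
  set D : ℕ → ℝ := fun n => phi q (x n) - phi q (w n) with hD
  have hDlim : Tendsto D atTop (𝓝 0) := by
    simpa using (tendsto_phi hE hxp q).sub (tendsto_phi hE hwp q)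
  have hstep : ∀ n, (β * phi (u n) (y n) + (1 - β) * phi (v n) (y n)) +
      (α n * phi (y n) (x n) + (1 - α n) * phi (y n) (S n (x n))) ≤ D n := fun n => by
    have := phi_step_le hf₁ hf₂ (hr0 n) (hα n) hβ (hF₁ hq) (hF₂ hq)
      (hFS n q hq _ (hxC n)) (h.y_eq n) (h.u_mem n) (h.u_ineq n) (h.v_mem n) (h.v_ineq n) (h.w_eq n)
    simp only [hD]
    linarith
  obtain ⟨a, ha0, ha⟩ := exists_between hαlim
  -- Both factors lie in (0, 1), so each exceeds their product, which eventually exceeds a.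
  have hev : ∀ᶠ n in atTop, a < α n ∧ a < 1 - α n := by
    have hb : IsBoundedUnder (· ≥ ·) atTop fun n => α n * (1 - α n) :=
      isBoundedUnder_of ⟨0, fun n => mul_nonneg (hα n).1.le (by linarith [(hα n).2])⟩
    filter_upwards [eventually_lt_of_lt_liminf ha hb] with n hn
    have h1 := (hα n).1
    have h2 := (hα n).2
    constructor <;> nlinarith
  have hsqueeze : ∀ {b : ℝ} {φ : ℕ → ℝ}, 0 < b → (∀ n, 0 ≤ φ n) → (∀ᶠ n in atTop, b * φ n ≤ D n) →
      Tendsto φ atTop (𝓝 0) := fun {b φ} hb h0 hle => by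
    have hlim := hDlim.const_mul b⁻¹
    rw [mul_zero] at hlim
    refine squeeze_zero' (Eventually.of_forall h0) ?_ hlim
    filter_upwards [hle] with n hn
    rwa [le_inv_mul_iff₀ hb]
  have hφ : ∀ s t : E, 0 ≤ phi s t := phi_nonneg
  have hβ0 := hβ.1
  have hβ1 : 0 < 1 - β := by linarith [hβ.2]
  have hterms : ∀ n, 0 ≤ β * phi (u n) (y n) ∧ 0 ≤ (1 - β) * phi (v n) (y n) ∧
      0 ≤ α n * phi (y n) (x n) ∧ 0 ≤ (1 - α n) * phi (y n) (S n (x n)) := fun n =>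
    ⟨mul_nonneg hβ0.le (hφ _ _), mul_nonneg hβ1.le (hφ _ _), mul_nonneg (hα n).1.le (hφ _ _),
      mul_nonneg (by linarith [(hα n).2]) (hφ _ _)⟩
  have hyx : Tendsto (fun n => phi (y n) (x n)) atTop (𝓝 0) :=
    hsqueeze ha0 (fun n => hφ _ _) (hev.mono fun n hn => by
      have := mul_le_mul_of_nonneg_right hn.1.le (hφ (y n) (x n))
      linarith [hstep n, hterms n])
  have hyS : Tendsto (fun n => phi (y n) (S n (x n))) atTop (𝓝 0) :=
    hsqueeze ha0 (fun n => hφ _ _) (hev.mono fun n hn => by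
      have := mul_le_mul_of_nonneg_right hn.2.le (hφ (y n) (S n (x n)))
      linarith [hstep n, hterms n])
  have huy : Tendsto (fun n => phi (u n) (y n)) atTop (𝓝 0) :=
    hsqueeze hβ0 (fun n => hφ _ _) (Eventually.of_forall fun n => by linarith [hstep n, hterms n])
  have hvy : Tendsto (fun n => phi (v n) (y n)) atTop (𝓝 0) :=
    hsqueeze hβ1 (fun n => hφ _ _) (Eventually.of_forall fun n => by linarith [hstep n, hterms n])
  have hyp : Tendsto y atTop (𝓝 p) := by
    simpa using (tendsto_sub_of_phi (R := R) (fun n => Or.inr (hxR n)) hyx).add hxp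
  obtain ⟨R', hR'⟩ := hyp.norm.bddAbove_range
  have hyR : ∀ n, ‖y n‖ ≤ R' := fun n => hR' ⟨n, rfl⟩
  have hSp : Tendsto (fun n => S n (x n)) atTop (𝓝 p) := by
    simpa using hyp.sub (tendsto_sub_of_phi (R := R') (fun n => Or.inl (hyR n)) hyS)
  have hup : Tendsto u atTop (𝓝 p) := by
    simpa using (tendsto_sub_of_phi (R := R') (fun n => Or.inr (hyR n)) huy).add hyp
  have hvp : Tendsto v atTop (𝓝 p) := by
    simpa using (tendsto_sub_of_phi (R := R') (fun n => Or.inr (hyR n)) hvy).add hyp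
  exact ⟨p, ⟨mem_EP_of_tendsto hE hcl hC hf₁ hc hr h.u_mem h.u_ineq hup hyp,
    mem_EP_of_tendsto hE hcl hC hf₂ hc hr h.v_mem h.v_ineq hvp hyp⟩, hxC, hxp, hSp⟩

end Scheme

end HybridEquilibrium

/-! ### The main theorem -/

theorem corollary1 {E : Type*} [NormedAddCommGroup E] [NormedSpace ℝ E] [CompleteSpace E]
    [UniformConvexSpace E] (hE : HybridEquilibrium.UniformlySmooth E)
    (C : Set E) (hC_ne : C.Nonempty) (hC_closed : IsClosed C) (hC_convex : Convex ℝ C)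
    (f₁ f₂ : E → E → ℝ)
    (hf₁ : HybridEquilibrium.EquilibriumConditions C f₁)
    (hf₂ : HybridEquilibrium.EquilibriumConditions C f₂)
    (d : ℕ) (hd : 0 < d) (T : Fin d → E → E)
    (hT : ∀ j, HybridEquilibrium.RelativelyNonexpansive C (T j))
    (hT_cont : ∀ j, ContinuousOn (T j) C)
    (F : Set E)
    (hF : F = (⋂ j, HybridEquilibrium.fixedPointSet C (T j)) ∩
      (HybridEquilibrium.EP C f₁ ∩ HybridEquilibrium.EP C f₂))
    (hF_ne : F.Nonempty)
    (r α : ℕ → ℝ) (β c₁ : ℝ) (hc₁ : 0 < c₁) (hr : ∀ n, c₁ ≤ r n)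
    (hβ : β ∈ Set.Ioo (0 : ℝ) 1) (hα : ∀ n, α n ∈ Set.Ioo (0 : ℝ) 1)
    (hα_liminf : 0 < Filter.liminf (fun n => α n * (1 - α n)) Filter.atTop) :
    (∀ x₀ ∈ C, ∃ (x y u v w : ℕ → E) (K : ℕ → Set E), x 0 = x₀ ∧
      HybridEquilibrium.IsHybridScheme C f₁ f₂ (fun n => T ⟨n % d, Nat.mod_lt n hd⟩)
        α r β x y u v w K) ∧
    (∀ (x y u v w : ℕ → E) (K : ℕ → Set E),
      HybridEquilibrium.IsHybridScheme C f₁ f₂ (fun n => T ⟨n % d, Nat.mod_lt n hd⟩)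
        α r β x y u v w K →
      ∃ p ∈ F, Filter.Tendsto x Filter.atTop (nhds p)) := by
  have hFC : F ⊆ C := by
    rw [hF]
    exact fun q hq => hq.2.1.1
  have hF₁ : F ⊆ HybridEquilibrium.EP C f₁ := by
    rw [hF]
    exact fun q hq => hq.2.1
  have hF₂ : F ⊆ HybridEquilibrium.EP C f₂ := by
    rw [hF]
    exact fun q hq => hq.2.2
  have hFS : ∀ n, ∀ q ∈ F, ∀ x ∈ C, HybridEquilibrium.phi q (T ⟨n % d, Nat.mod_lt n hd⟩ x)
      ≤ HybridEquilibrium.phi q x := by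
    rw [hF]
    exact fun n q hq x hx => (hT _).phi_le x hx q (Set.mem_iInter.1 hq.1 _)
  refine ⟨fun x₀ hx₀ => HybridEquilibrium.exists_isHybridScheme hE hC_closed hC_convex hf₁ hf₂
    hF_ne hFC hF₁ hF₂ hFS (fun n => hc₁.trans_le (hr n)) hα hβ hx₀,
    fun x y u v w K h => ?_⟩
  obtain ⟨p, hpEP, hxC, hxp, hSp⟩ := h.exists_tendsto hE hC_closed hC_convex hf₁ hf₂ hF_ne hFC
    hF₁ hF₂ hFS hc₁ hr hα hβ hα_liminf
  refine ⟨p, ?_, hxp⟩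
  rw [hF]
  refine ⟨Set.mem_iInter.2 fun j => ⟨hpEP.1.1, ?_⟩, hpEP⟩
  -- Residues in {1, …, d} are shifted to `Fin d`, so T_{n+1} has index n % d; along n = kd + j the
  -- step map is constantly `T j`.
  have hsub : Tendsto (fun k => k * d + j) atTop atTop :=
    tendsto_atTop_mono (fun k => (Nat.le_mul_of_pos_right k hd).trans (Nat.le_add_right _ _))
      tendsto_id
  have h1 : Tendsto (fun k => T j (x (k * d + j))) atTop (𝓝 p) := by
    refine (hSp.comp hsub).congr fun k => ?_
    have hj : (⟨(k * d + j) % d, Nat.mod_lt _ hd⟩ : Fin d) = j := Fin.ext (Nat.mul_add_mod_of_lt j.2)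
    simp only [Function.comp_apply, hj]
  have h2 : Tendsto (fun k => T j (x (k * d + j))) atTop (𝓝 (T j p)) :=
    (hT_cont j p hpEP.1.1).tendsto.comp (tendsto_nhdsWithin_iff.2
      ⟨hxp.comp hsub, Eventually.of_forall fun k => hxC _⟩)
  exact tendsto_nhds_unique h2 h1
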